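/- Let $G$ be a locally compact second countable (Hausdorff) abelian group with Haar measure $m_G$. A \emph{strong F\o lner sequence} in $G$ is an increasing sequence $\mathcal F=(F_n)_{n\in\mathbb N}$ of compact sets with $\bigcup_n F_n=G$ such that $m_G(F_n+K)/m_G(F_n)\to 1$ for every nonempty compact $K\subset G$, and such that $m_G\big(\bigcap_{u\in U}(F_n-u)\big)/m_G(F_n)\to 1$ for some identity neighborhood $U\subset G$. For a set $Q\subset G$ put $$d_{\mathcal F}(Q)=\limsup_{n\to\infty}\frac{|Q\cap F_n|}{m_G(F_n)}\in[0,+\infty].$$ Let $H$ be a locally compact second countable (Hausdorff) abelian group with Haar measure $m_H$, and let $(G,H;\Gamma)$ be a cut-and-project scheme: $\Gamma<G\times H$ is a lattice (a discrete subgroup of finite covolume) such that $\operatorname{proj}_G|_\Gamma$ is injective and $\operatorname{proj}_H(\Gamma)$ is dense in $H$. Let $\operatorname{covol}_{G\times H}(\Gamma)$ be the measure of a fundamental domain of $\Gamma$ with respect to $m_G\otimes m_H$. Call a subset of $H$ \emph{Jordan measurable} if its topological boundary is $m_H$-null. Let $W\subset H$ be a \emph{window}, i.e. a relatively compact Jordan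 measurable set with $0<m_H(W)<+\infty$, and suppose that $W-W$ is Jordan measurable. Put $P=\operatorname{proj}_G\big(\Gamma\cap(G\times W)\big)\subset G$, and let $W^o$ be the interior of $W$. Then for every strong F\o lner sequence $\mathcal F$ in $G$, $$d_{\mathcal F}(P)=\operatorname{covol}_{G\times H}(\Gamma)^{-1}\cdot m_H(W)$$ and $$\operatorname{covol}_{G\times H}(\Gamma)^{-1}\cdot m_H(W^o-W^o)\le d_{\mathcal F}(P-P)\le \operatorname{covol}_{G\times H}(\Gamma)^{-1}\cdot m_H(W-W).$$ In particular, when $H=\mathbb R$, with Haar measure $m_{\mathbb R}$, and $W=[a,b]\subset\mathbb R$ with $a<b$, $$d_{\mathcal F}(P-P)=2\cdot\operatorname{covol}_{G\times\mathbb R}(\Gamma)^{-1}\cdot m_{\mathbb R}(W)=2\cdot d_{\mathcal F}(P).$$ -/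

import Mathlib

open MeasureTheory Filter Topology Set
open scoped ENNReal Pointwise

namespace CutProject

/-- A sequence of sets `F n` in an abelian group `G` (with Haar measure `m`) is a strong Følner
sequence if it is an increasing exhaustion of `G` by compact sets which is asymptotically invariant
under thickening by compact sets, and which is `U`-adapted for some identity neighborhood `U`.
(Taking `K = {0, g}` in `thickening` shows that such a sequence is Følner.) -/
structure IsStrongFolner {G : Type*} [AddCommGroup G] [TopologicalSpace G] [MeasurableSpace G]
    (m : Measure G) (F : ℕ → Set G) : Prop where
  compact : ∀ n, IsCompact (F n)
  increasing : Monotone F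
  exhaustion : ⋃ n, F n = univ
  thickening : ∀ K : Set G, IsCompact K → K.Nonempty →
    Tendsto (fun n => m (F n + K) / m (F n)) atTop (𝓝 1)
  adapted : ∃ U ∈ 𝓝 (0 : G),
    Tendsto (fun n => m (⋂ u ∈ U, (F n - {u})) / m (F n)) atTop (𝓝 1)

/-- The asymptotic density of `P` along `F`: the upper limit of `|P ∩ F n| / m (F n)`, as an
extended nonnegative real. -/
noncomputable def asymptoticDensity {G : Type*} [MeasurableSpace G]
    (m : Measure G) (F : ℕ → Set G) (P : Set G) : ℝ≥0∞ :=
  limsup (fun n => ((P ∩ F n).encard : ℝ≥0∞) / m (F n)) atTop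

/-- A set is Jordan measurable if its topological boundary is a null set. -/
def IsJordanMeasurable {H : Type*} [TopologicalSpace H] [MeasurableSpace H]
    (m : Measure H) (W : Set H) : Prop :=
  m (frontier W) = 0

/-- A window is a relatively compact Jordan measurable set of positive finite measure. -/
structure IsWindow {H : Type*} [TopologicalSpace H] [MeasurableSpace H]
    (m : Measure H) (W : Set H) : Prop where
  relativelyCompact : IsCompact (closure W)
  jordan : IsJordanMeasurable m W
  measure_pos : 0 < m W
  measure_lt_top : m W < ∞

/-- A lattice is a discrete subgroup admitting a fundamental domain of finite measure. -/
structure IsLattice {A : Type*} [AddCommGroup A] [TopologicalSpace A] [MeasurableSpace A]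
    (m : Measure A) (Γ : AddSubgroup A) : Prop where
  discrete : DiscreteTopology Γ
  finite_covolume : ∃ D : Set A, IsAddFundamentalDomain Γ D m ∧ m D < ∞

/-- The covolume of a lattice `Γ < G × H` with respect to the product of the Haar measures, that
is, the measure of a fundamental domain. -/
noncomputable def covol {G H : Type*} [AddCommGroup G] [AddCommGroup H]
    [MeasurableSpace G] [MeasurableSpace H] (mG : Measure G) (mH : Measure H)
    (Γ : AddSubgroup (G × H)) : ℝ≥0∞ :=
  addCovolume Γ (G × H) (mG.prod mH)

/-- `(G, H; Γ)` is a cut-and-project scheme: `Γ` is a lattice in `G × H` that projects injectively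
to `G` and densely to `H`. -/
structure IsCutAndProjectScheme {G H : Type*} [AddCommGroup G] [AddCommGroup H]
    [TopologicalSpace G] [TopologicalSpace H] [MeasurableSpace G] [MeasurableSpace H]
    (mG : Measure G) (mH : Measure H) (Γ : AddSubgroup (G × H)) : Prop where
  lattice : IsLattice (mG.prod mH) Γ
  injective : InjOn Prod.fst (Γ : Set (G × H))
  dense : Dense (Prod.snd '' (Γ : Set (G × H)))

/-- The cut-and-project set `proj_G (Γ ∩ (G × W))`. -/
def cutAndProjectSet {G H : Type*} [AddCommGroup G] [AddCommGroup H]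
    (Γ : AddSubgroup (G × H)) (W : Set H) : Set G :=
  Prod.fst '' ((Γ : Set (G × H)) ∩ (univ ×ˢ W))

end CutProject

universe u v

open CutProject

/-! Integrating the number of points of `y + Γ` in `E` over a fundamental domain gives the measure
of `E` (`setLIntegral_cosetCount`), so the average count in `F ×ˢ W` is `mG F * mH W / covol`. Since
`Γ` is cocompact with dense projection to `H`, every coset meets `C ×ˢ V` for a compact `C` and an
arbitrarily small neighborhood `V` of `0`. Hence the count for `Γ` itself differs from that of any
other coset only by thickening or eroding `F` by `C` and the window by `V`. The strong Følner
property makes the first error negligible and regularity of `mH` the second. This bounds the density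
above for compact windows and below for open ones; for Jordan measurable `W` the two bounds meet.

For differences, `P - P` lies in the cut-and-project set of `W - W`, and by density of the
projection it contains that of `interior W - interior W`. For an interval these two windows have the
same measure, twice that of `W`. -/

namespace CutProject

/-! ### Counting coset points and averaging over a fundamental domain -/

section Count

variable {A : Type*} [AddCommGroup A]

/-- The number of points of the coset `y + Γ` which lie in `E`. -/
noncomputable def cosetCount (Γ : AddSubgroup A) (E : Set A) (y : A) : ℝ≥0∞ :=
  ({γ : Γ | y + γ ∈ E}.encard : ℝ≥0∞)

lemma cosetCount_eq_tsum (Γ : AddSubgroup A) (E : Set A) (y : A) :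
    cosetCount Γ E y = ∑' γ : Γ, E.indicator 1 (y + (γ : A)) := by
  rw [cosetCount, ← ENNReal.tsum_set_one, tsum_subtype {γ : Γ | y + γ ∈ E} (fun _ => (1 : ℝ≥0∞))]
  rfl

lemma cosetCount_le_of_shift {Γ : AddSubgroup A} {E E' : Set A} {y y' : A} (δ : Γ)
    (h : ∀ γ : Γ, y + γ ∈ E → y' + (γ + δ : Γ) ∈ E') :
    cosetCount Γ E y ≤ cosetCount Γ E' y' := by
  refine ENat.toENNReal_le.2 ?_
  rw [← (add_left_injective δ).encard_image]
  refine encard_le_encard ?_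
  rintro _ ⟨γ, hγ, rfl⟩
  exact h γ hγ

lemma setLIntegral_cosetCount [MeasurableSpace A] [MeasurableAdd₂ A] {μ : Measure A}
    [μ.IsAddLeftInvariant] {Γ : AddSubgroup A} [Countable Γ] {D : Set A}
    (hD : IsAddFundamentalDomain Γ D μ) {E : Set A} (hE : MeasurableSet E) :
    ∫⁻ y in D, cosetCount Γ E y ∂μ = μ E := by
  simp_rw [cosetCount_eq_tsum]
  rw [lintegral_tsum]
  -- The unfolding formula translates by `-γ`, hence the reindexing by negation.
  · rw [← lintegral_indicator_one hE, hD.lintegral_eq_tsum', ← (Equiv.neg Γ).tsum_eq]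
    refine tsum_congr fun γ => lintegral_congr fun y => ?_
    simp [AddSubgroup.vadd_def, add_comm]
  · intro γ
    exact ((measurable_one.indicator hE).comp (measurable_add_const _)).aemeasurable

end Count

section Discrete

variable {A : Type*} [AddCommGroup A] [TopologicalSpace A]

lemma IsLattice.countable [SecondCountableTopology A] [MeasurableSpace A] {μ : Measure A}
    {Γ : AddSubgroup A} (h : IsLattice μ Γ) : Countable Γ :=
  have := h.discrete
  countable_of_Lindelof_of_discrete

lemma exists_isOpen_sub_mem_imp_eq [IsTopologicalAddGroup A] {Γ : AddSubgroup A} [DiscreteTopology Γ] :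
    ∃ N : Set A, IsOpen N ∧ (0 : A) ∈ N ∧ ∀ x ∈ N, ∀ y ∈ N, x - y ∈ Γ → x = y := by
  obtain ⟨O, hO, hO'⟩ := isOpen_induced_iff.1 (isOpen_discrete ({0} : Set Γ))
  have h0 : (0 : A) ∈ O := by
    have : (0 : Γ) ∈ ((↑) : Γ → A) ⁻¹' O := by rw [hO']; rfl
    simpa using this
  have hc : ContinuousAt (fun p : A × A => p.1 - p.2) (0, 0) := by fun_prop
  have := hc.preimage_mem_nhds (t := O) (by simpa using hO.mem_nhds h0)
  rw [nhds_prod_eq, mem_prod_self_iff] at this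
  obtain ⟨t, ht, hts⟩ := this
  refine ⟨interior t, isOpen_interior, mem_interior_iff_mem_nhds.2 ht, fun x hx y hy hxy => ?_⟩
  have h1 : x - y ∈ O := hts (mk_mem_prod (interior_subset hx) (interior_subset hy))
  have h2 : (⟨x - y, hxy⟩ : Γ) ∈ ((↑) : Γ → A) ⁻¹' O := h1
  rw [hO'] at h2
  exact sub_eq_zero.1 (congrArg Subtype.val h2)

end Discrete

/-! ### Cocompactness of lattices -/

section Lattice

variable {A : Type*} [AddCommGroup A] [TopologicalSpace A] [IsTopologicalAddGroup A] [T2Space A]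
  [LocallyCompactSpace A] [SecondCountableTopology A] [MeasurableSpace A] [BorelSpace A]
  {μ : Measure A} [μ.IsAddHaarMeasure] {Γ : AddSubgroup A}

/-- A lattice is cocompact. -/
lemma IsLattice.exists_isCompact (h : IsLattice μ Γ) :
    ∃ L : Set A, IsCompact L ∧ ∀ x : A, ∃ γ : Γ, x + γ ∈ L := by
  have := h.discrete
  have := h.countable
  obtain ⟨D, hD, hDfin⟩ := h.finite_covolume
  obtain ⟨N, hNo, hN0, hN⟩ := exists_isOpen_sub_mem_imp_eq (Γ := Γ)
  obtain ⟨M, hM, hM0, hMN⟩ := exists_compact_subset hNo hN0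
  have hMpos : μ M ≠ 0 := (Measure.measure_pos_of_mem_nhds μ (mem_interior_iff_mem_nhds.1 hM0)).ne'
  have : IsFiniteMeasure (μ.restrict D) := ⟨by simpa using hDfin⟩
  -- Inner regularity gives a compact `L` with `μ (D \ L) < μ M`.
  obtain ⟨L, -, hL, -, hDL⟩ := MeasurableSet.univ.exists_isCompact_isClosed_sdiff_lt
    (measure_ne_top (μ.restrict D) univ) hMpos
  refine ⟨L - M, by simpa only [sub_eq_add_neg] using hL.add hM.neg, fun x => ?_⟩
  by_contra! hx
  have hE : IsCompact (x +ᵥ M) := hM.vadd x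
  -- If `x + Γ` misses `L - M`, cosets of points of `L` miss `x + M`. Any coset meets `x + M` at
  -- most once, as distinct points of `M` are inequivalent modulo `Γ`. Integrating over `D` gives `μ
  -- M ≤ μ (D \ L)`, a contradiction.
  have hcount : ∀ y, cosetCount Γ (x +ᵥ M) y ≤ Lᶜ.indicator 1 y := by
    intro y
    by_cases hy : y ∈ L
    · have : {γ : Γ | y + γ ∈ x +ᵥ M} = ∅ := by
        refine eq_empty_of_forall_notMem fun γ hγ => ?_
        obtain ⟨m, hm, hxm⟩ := hγ
        refine hx (-γ) ?_
        refine ⟨y, hy, m, hm, ?_⟩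
        have : x + m = y + γ := hxm
        simp only [AddSubgroup.coe_neg]
        rw [sub_eq_iff_eq_add, add_right_comm, this]; abel
      simp [cosetCount, this]
    · have : {γ : Γ | y + γ ∈ x +ᵥ M}.encard ≤ 1 := by
        rw [encard_le_one_iff]
        rintro γ γ' ⟨m, hm, hxm⟩ ⟨m', hm', hxm'⟩
        simp only at hxm hxm'
        have hsub : m - m' = γ - γ' := by
          rw [eq_sub_of_add_eq' hxm, eq_sub_of_add_eq' hxm']; abel
        have := hN m (hMN hm) m' (hMN hm') (by rw [hsub]; exact (γ - γ').2)
        rw [this, sub_self] at hsub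
        exact Subtype.ext (sub_eq_zero.1 hsub.symm)
      simpa [cosetCount, hy] using ENat.toENNReal_le.2 this
  have := calc
    μ M = μ (x +ᵥ M) := (measure_vadd _ _ _).symm
    _ = ∫⁻ y in D, cosetCount Γ (x +ᵥ M) y ∂μ :=
      (setLIntegral_cosetCount hD hE.measurableSet).symm
    _ ≤ ∫⁻ y in D, Lᶜ.indicator 1 y ∂μ := lintegral_mono hcount
    _ = μ.restrict D (univ \ L) := by
      rw [lintegral_indicator_one hL.measurableSet.compl, compl_eq_univ_sdiff]
  exact absurd hDL (not_lt.2 this)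

end Lattice

section PointCount

variable {G H : Type*} [AddCommGroup G] [AddCommGroup H] [TopologicalSpace G] [TopologicalSpace H]
  [MeasurableSpace G] [MeasurableSpace H] {mG : Measure G} {mH : Measure H}
  {Γ : AddSubgroup (G × H)}

lemma IsCutAndProjectScheme.encard_inter (h : IsCutAndProjectScheme mG mH Γ) (F : Set G)
    (W : Set H) : ((cutAndProjectSet Γ W ∩ F).encard : ℝ≥0∞) = cosetCount Γ (F ×ˢ W) 0 := by
  have hinj : Function.Injective (fun γ : Γ => (γ : G × H).1) :=
    fun a b hab => Subtype.ext (h.injective a.2 b.2 hab)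
  rw [cosetCount, ← hinj.encard_image]
  congr 2
  ext g
  constructor
  · rintro ⟨⟨γ, ⟨hγ, -, hW⟩, rfl⟩, hF⟩
    exact ⟨⟨γ, hγ⟩, by simpa using ⟨hF, hW⟩, rfl⟩
  · rintro ⟨γ, hγ, rfl⟩
    simp only [zero_add, mem_ofPred_eq, mem_prod] at hγ
    exact ⟨⟨γ, ⟨γ.2, mem_univ _, hγ.2⟩, rfl⟩, hγ.1⟩

end PointCount

section Covolume

variable {G H : Type*} [AddCommGroup G] [TopologicalSpace G] [IsTopologicalAddGroup G]
  [LocallyCompactSpace G] [SecondCountableTopology G] [MeasurableSpace G] [BorelSpace G]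
  [AddCommGroup H] [TopologicalSpace H] [IsTopologicalAddGroup H]
  [LocallyCompactSpace H] [SecondCountableTopology H] [MeasurableSpace H] [BorelSpace H]
  {mG : Measure G} [mG.IsAddHaarMeasure] {mH : Measure H} [mH.IsAddHaarMeasure]
  {Γ : AddSubgroup (G × H)}

lemma IsLattice.covol_eq (h : IsLattice (mG.prod mH) Γ) {D : Set (G × H)}
    (hD : IsAddFundamentalDomain Γ D (mG.prod mH)) : covol mG mH Γ = mG.prod mH D :=
  have := h.countable
  hD.covolume_eq_volume _

lemma IsLattice.covol_ne_top (h : IsLattice (mG.prod mH) Γ) : covol mG mH Γ ≠ ∞ := by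
  obtain ⟨D, hD, hDfin⟩ := h.finite_covolume
  rw [h.covol_eq hD]
  exact hDfin.ne

lemma IsLattice.covol_ne_zero (h : IsLattice (mG.prod mH) Γ) : covol mG mH Γ ≠ 0 := by
  have := h.countable
  obtain ⟨D, hD, hDfin⟩ := h.finite_covolume
  rw [h.covol_eq hD]
  exact hD.measure_ne_zero (NeZero.ne _)

lemma IsLattice.lintegral_cosetCount (h : IsLattice (mG.prod mH) Γ) :
    ∃ D, mG.prod mH D = covol mG mH Γ ∧ ∀ E, MeasurableSet E →
      ∫⁻ y in D, cosetCount Γ E y ∂(mG.prod mH) = mG.prod mH E := by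
  have := h.countable
  obtain ⟨D, hD, -⟩ := h.finite_covolume
  exact ⟨D, (h.covol_eq hD).symm, fun E hE => setLIntegral_cosetCount hD hE⟩

end Covolume

/-! ### Comparison of the lattice count with its average -/

section Scheme

variable {G H : Type*} [AddCommGroup G] [TopologicalSpace G] [IsTopologicalAddGroup G] [T2Space G]
  [LocallyCompactSpace G] [SecondCountableTopology G] [MeasurableSpace G] [BorelSpace G]
  [AddCommGroup H] [TopologicalSpace H] [IsTopologicalAddGroup H] [T2Space H]
  [LocallyCompactSpace H] [SecondCountableTopology H] [MeasurableSpace H] [BorelSpace H]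
  {mG : Measure G} [mG.IsAddHaarMeasure] {mH : Measure H} [mH.IsAddHaarMeasure]
  {Γ : AddSubgroup (G × H)}

/-- Modulo `Γ`, every point lies in a compact slice over a prescribed identity neighborhood. -/
lemma IsCutAndProjectScheme.exists_isCompact (h : IsCutAndProjectScheme mG mH Γ) {V : Set H}
    (hV : V ∈ 𝓝 (0 : H)) :
    ∃ C : Set G, IsCompact C ∧ ∀ y : G × H, ∃ γ : Γ, y + γ ∈ C ×ˢ V := by
  obtain ⟨L, hL, hLc⟩ := h.lattice.exists_isCompact
  -- By density some `γ` moves the `H`-coordinate of `x` into `V`; the same `γ` serves all nearby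
  -- points, and compactness of `L` leaves finitely many.
  have hloc : ∀ x ∈ L, ∃ t ∈ 𝓝[L] x, ∃ C : Set G, IsCompact C ∧
      ∀ y ∈ t, y ∈ L → ∃ γ : Γ, y + γ ∈ C ×ˢ V := by
    intro x _
    have hc : ContinuousAt (fun p : H × H => p.1 + p.2) (x.2, -x.2) := by fun_prop
    have h1 := hc.preimage_mem_nhds (t := V) (by simpa using hV)
    rw [nhds_prod_eq, mem_prod_iff] at h1
    obtain ⟨t, ht, s, hs, hts⟩ := h1
    obtain ⟨_, ⟨γ, hγ, rfl⟩, hγs⟩ := h.dense.inter_nhds_nonempty hs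
    refine ⟨Prod.snd ⁻¹' t, mem_nhdsWithin_of_mem_nhds (continuous_snd.continuousAt ht),
      Prod.fst '' L + {γ.1}, (hL.image continuous_fst).add isCompact_singleton, ?_⟩
    intro y hy hyL
    exact ⟨⟨γ, hγ⟩, add_mem_add ⟨y, hyL, rfl⟩ rfl, hts (mk_mem_prod hy hγs)⟩
  obtain ⟨C, hC, hCL⟩ := hL.induction_on
    (p := fun t => ∃ C : Set G, IsCompact C ∧ ∀ y ∈ t, y ∈ L → ∃ γ : Γ, y + γ ∈ C ×ˢ V)
    ⟨∅, isCompact_empty, by simp⟩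
    (fun s t hst ⟨C, hC, hCt⟩ => ⟨C, hC, fun y hy => hCt y (hst hy)⟩)
    (fun s t ⟨C, hC, hCs⟩ ⟨C', hC', hCt⟩ => ⟨C ∪ C', hC.union hC', fun y hy hyL => by
      rcases hy with hy | hy
      · obtain ⟨γ, hγ⟩ := hCs y hy hyL
        exact ⟨γ, Or.inl hγ.1, hγ.2⟩
      · obtain ⟨γ, hγ⟩ := hCt y hy hyL
        exact ⟨γ, Or.inr hγ.1, hγ.2⟩⟩) hloc
  refine ⟨C, hC, fun y => ?_⟩
  obtain ⟨γ, hγ⟩ := hLc y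
  obtain ⟨γ', hγ'⟩ := hCL _ hγ hγ
  exact ⟨γ + γ', by simpa [add_assoc] using hγ'⟩

/-- With `K + V ⊆ U` and `y + δ ∈ C ×ˢ V`, the shift by `y + δ` carries lattice points in `F ×ˢ K`
to points of `y + Γ` in `(F + C) ×ˢ U`. Integrating this comparison over a fundamental domain gives
the bound. -/
lemma IsCutAndProjectScheme.covol_mul_cosetCount_le (h : IsCutAndProjectScheme mG mH Γ)
    {K U : Set H} (hK : IsCompact K) (hU : IsOpen U) (hKU : K ⊆ U) :
    ∃ C : Set G, IsCompact C ∧ C.Nonempty ∧ ∀ F : Set G, IsCompact F →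
      covol mG mH Γ * cosetCount Γ (F ×ˢ K) 0 ≤ mG (F + C) * mH U := by
  obtain ⟨V, hV, hKV⟩ := compact_open_separated_add_right hK hU hKU
  obtain ⟨C, hC, hCV⟩ := h.exists_isCompact hV
  obtain ⟨D, hD, hint⟩ := h.lattice.lintegral_cosetCount
  refine ⟨C, hC, let ⟨_, hδ⟩ := hCV 0; ⟨_, hδ.1⟩, fun F hF => ?_⟩
  rw [← Measure.prod_prod, ← hint _ ((hF.add hC).measurableSet.prod hU.measurableSet), mul_comm,
    ← hD, ← setLIntegral_const]
  refine lintegral_mono fun y => ?_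
  obtain ⟨δ, hδ⟩ := hCV y
  refine cosetCount_le_of_shift δ fun γ hγ => ?_
  have : y + ((γ + δ : Γ) : G × H) = (0 + γ) + (y + δ) := by push_cast; abel
  rw [this]
  exact ⟨add_mem_add hγ.1 hδ.1, hKV (add_mem_add hγ.2 hδ.2)⟩

/-- The reverse comparison: a point `-y + δ` of `C ×ˢ V` shifts `y + Γ` back onto `Γ`. -/
lemma IsCutAndProjectScheme.le_covol_mul_cosetCount (h : IsCutAndProjectScheme mG mH Γ)
    {K U : Set H} (hK : IsCompact K) (hU : IsOpen U) (hKU : K ⊆ U) :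
    ∃ C : Set G, IsCompact C ∧ ∀ F F' : Set G, MeasurableSet F' → F' + C ⊆ F →
      mG F' * mH K ≤ covol mG mH Γ * cosetCount Γ (F ×ˢ U) 0 := by
  obtain ⟨V, hV, hKV⟩ := compact_open_separated_add_right hK hU hKU
  obtain ⟨C, hC, hCV⟩ := h.exists_isCompact hV
  obtain ⟨D, hD, hint⟩ := h.lattice.lintegral_cosetCount
  refine ⟨C, hC, fun F F' hF' hFF' => ?_⟩
  rw [← Measure.prod_prod, ← hint _ (hF'.prod hK.measurableSet), mul_comm, ← hD,
    ← setLIntegral_const]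
  refine lintegral_mono fun y => ?_
  obtain ⟨δ, hδ⟩ := hCV (-y)
  refine cosetCount_le_of_shift δ fun γ hγ => ?_
  have : (0 : G × H) + ((γ + δ : Γ) : G × H) = (y + γ) + (-y + δ) := by push_cast; abel
  rw [this]
  exact ⟨hFF' (add_mem_add hγ.1 hδ.1), hKV (add_mem_add hγ.2 hδ.2)⟩

end Scheme

lemma asymptoticDensity_mono {G : Type*} [MeasurableSpace G] (m : Measure G) (F : ℕ → Set G)
    {P Q : Set G} (h : P ⊆ Q) : asymptoticDensity m F P ≤ asymptoticDensity m F Q := by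
  refine limsup_le_limsup (Eventually.of_forall fun n => ?_)
  have : ((P ∩ F n).encard : ℝ≥0∞) ≤ (Q ∩ F n).encard :=
    ENat.toENNReal_le.2 (encard_le_encard (inter_subset_inter_left _ h))
  simp only
  gcongr

lemma cutAndProjectSet_mono {G H : Type*} [AddCommGroup G] [AddCommGroup H]
    (Γ : AddSubgroup (G × H)) {W W' : Set H} (h : W ⊆ W') :
    cutAndProjectSet Γ W ⊆ cutAndProjectSet Γ W' :=
  image_mono (inter_subset_inter_right _ (prod_mono_right h))

lemma cutAndProjectSet_sub_subset {G H : Type*} [AddCommGroup G] [AddCommGroup H]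
    (Γ : AddSubgroup (G × H)) (W W' : Set H) :
    cutAndProjectSet Γ W - cutAndProjectSet Γ W' ⊆ cutAndProjectSet Γ (W - W') := by
  rintro _ ⟨_, ⟨γ, ⟨hγ, -, hW⟩, rfl⟩, _, ⟨γ', ⟨hγ', -, hW'⟩, rfl⟩, rfl⟩
  exact ⟨γ - γ', ⟨Γ.sub_mem hγ hγ', mem_univ _, sub_mem_sub hW hW'⟩, rfl⟩

/-- If `γ.2` is a difference of interior points, the `h` with both `h` and `γ.2 + h` in `interior W`
form a nonempty open set. It contains `δ.2` for some `δ ∈ Γ`, and `γ = (γ + δ) - δ`. -/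
lemma cutAndProjectSet_interior_sub_subset {G H : Type*} [AddCommGroup G] [AddCommGroup H]
    [TopologicalSpace H] [IsTopologicalAddGroup H] {Γ : AddSubgroup (G × H)}
    (hΓ : Dense (Prod.snd '' (Γ : Set (G × H)))) (W : Set H) :
    cutAndProjectSet Γ (interior W - interior W) ⊆
      cutAndProjectSet Γ W - cutAndProjectSet Γ W := by
  rintro _ ⟨γ, ⟨hγ, -, w, hw, w', hw', hww'⟩, rfl⟩
  have hc : Continuous fun h : H => γ.2 + h := by fun_prop
  have hO : IsOpen ((fun h : H => γ.2 + h) ⁻¹' interior W ∩ interior W) :=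
    (isOpen_interior.preimage hc).inter isOpen_interior
  have hwγ : γ.2 + w' = w := by rw [← hww']; exact sub_add_cancel w w'
  obtain ⟨_, ⟨δ, hδ, rfl⟩, h1, h2⟩ :=
    hΓ.exists_mem_open hO ⟨w', by simpa [hwγ] using hw, hw'⟩
  exact ⟨(γ + δ).1, ⟨γ + δ, ⟨Γ.add_mem hγ hδ, mem_univ _, interior_subset h1⟩, rfl⟩,
    δ.1, ⟨δ, ⟨hδ, mem_univ _, interior_subset h2⟩, rfl⟩, by simp⟩

/-! ### Erosion of strong Følner sequences -/

section Folner

variable {G : Type*} [AddCommGroup G] [TopologicalSpace G] [IsTopologicalAddGroup G] [T2Space G]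
  [MeasurableSpace G] [BorelSpace G] {m : Measure G} [m.IsAddHaarMeasure] {F : ℕ → Set G}

/-- Erosion of a strong Følner sequence by a compact set is asymptotically negligible. -/
lemma IsStrongFolner.exists_erosion (hF : IsStrongFolner m F) {C : Set G} (hC : IsCompact C) :
    ∃ E : ℕ → Set G, (∀ n, MeasurableSet (E n)) ∧ (∀ n, E n + C ⊆ F n) ∧
      ∃ a : ℕ → ℝ≥0∞, Tendsto a atTop (𝓝 1) ∧ ∀ n, a n ≤ m (E n) / m (F n) := by
  obtain ⟨U, hU, hT⟩ := hF.adapted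
  set T : ℕ → Set G := fun n => ⋂ u ∈ U, (F n - {u}) with hTdef
  have hTF : ∀ n, T n ⊆ F n := fun n x hx => by
    have := mem_iInter₂.1 hx 0 (mem_of_mem_nhds hU)
    simpa using this
  have hTm : ∀ n, MeasurableSet (T n) := fun n => by
    refine (isClosed_biInter fun u _ => IsCompact.isClosed ?_).measurableSet
    simpa only [sub_eq_add_neg] using (hF.compact n).add isCompact_singleton.neg
  obtain ⟨s, -, hs⟩ := hC.elim_nhds_subcover (fun c => c +ᵥ U) fun c _ => by
    simpa using vadd_mem_nhds_vadd c hU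
  -- `F n + K` contains every translate `T n - c` with `c ∈ s`; the `0` keeps `K` nonempty when `s`
  -- is empty.
  set K : Set G := insert 0 (-(s : Set G)) with hK
  have hKfin : K.Finite := (s.finite_toSet.neg).insert 0
  have hM := hF.thickening K hKfin.isCompact ⟨0, mem_insert _ _⟩
  have hMc : ∀ n, IsCompact (F n + K) := fun n => (hF.compact n).add hKfin.isCompact
  have hpre : ∀ c n, MeasurableSet ((fun x => x + c) ⁻¹' T n) := fun c n =>
    (measurable_add_const c) (hTm n)
  have hsub : ∀ c ∈ s, ∀ n, (fun x => x + c) ⁻¹' T n ⊆ F n + K := fun c hc n x hx =>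
    ⟨x + c, hTF n hx, -c, Or.inr (by simpa using hc), by simp⟩
  -- If `x + c ∈ T n` for all `c ∈ s`, then `x + c + u ∈ F n` for all `u ∈ U`, and the sets `c + U`
  -- cover `C`. Each `T n - c` omits measure `m (F n + K) - m (T n)` of `F n + K`, so a union bound
  -- over `s` gives `a n`.
  refine ⟨fun n => ⋂ c ∈ s, (fun x => x + c) ⁻¹' T n,
    fun n => s.measurableSet_biInter fun c _ => hpre c n, ?_,
    fun n => m (F n + K) / m (F n) - s.card * (m (F n + K) / m (F n) - m (T n) / m (F n)), ?_, ?_⟩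
  · rintro n _ ⟨x, hx, c, hc, rfl⟩
    obtain ⟨c', hc', hcU⟩ := mem_iUnion₂.1 (hs hc)
    obtain ⟨u, hu, rfl⟩ := hcU
    obtain ⟨f, hf, v, hv, hfu⟩ := mem_iInter₂.1 (mem_iInter₂.1 hx c' hc') u hu
    have hfu' : f - u = x + c' := mem_singleton_iff.1 hv ▸ hfu
    have : x + (c' + u) = f := by rw [← add_assoc, ← hfu', sub_add_cancel]
    simpa [this] using hf
  · have h1 := ENNReal.Tendsto.sub hM hT (Or.inl ENNReal.one_ne_top)
    have h2 := ENNReal.Tendsto.const_mul (a := (s.card : ℝ≥0∞)) h1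
      (Or.inr (ENNReal.natCast_ne_top _))
    simpa only [tsub_self, mul_zero, tsub_zero] using
      ENNReal.Tendsto.sub hM h2 (Or.inl ENNReal.one_ne_top)
  · intro n
    have hle : m (F n + K) ≤ m (⋂ c ∈ s, (fun x => x + c) ⁻¹' T n) +
        s.card * (m (F n + K) - m (T n)) := by
      have hcov : F n + K ⊆ (⋂ c ∈ s, (fun x => x + c) ⁻¹' T n) ∪
          ⋃ c ∈ s, ((F n + K) \ (fun x => x + c) ⁻¹' T n) := by
        intro x hx
        by_cases h : x ∈ ⋂ c ∈ s, (fun x => x + c) ⁻¹' T n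
        · exact Or.inl h
        · right
          simp only [mem_iInter, not_forall] at h
          obtain ⟨c, hc, hxc⟩ := h
          exact mem_iUnion₂.2 ⟨c, hc, hx, hxc⟩
      refine (measure_mono hcov).trans ((measure_union_le _ _).trans ?_)
      gcongr
      refine (measure_biUnion_finset_le _ _).trans ?_
      rw [← nsmul_eq_mul]
      refine Finset.sum_le_card_nsmul _ _ _ fun c hc => ?_
      rw [measure_sdiff (hsub c hc n) (hpre c n).nullMeasurableSet
        ((measure_mono (hsub c hc n)).trans_lt (hMc n).measure_lt_top).ne,
        measure_preimage_add_right]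
    rw [tsub_le_iff_right, ← ENNReal.sub_div, ← mul_div_assoc, ← ENNReal.add_div]
    · gcongr
    -- Distributing the division over the subtraction requires `m (F n) ≠ 0` when `m (T n) > 0`.
    · intro h0 _ h
      exact h0.not_ge (h ▸ measure_mono (hTF n))

end Folner

/-! ### Density bounds for compact and open windows -/

section Density

variable {G H : Type*} [AddCommGroup G] [TopologicalSpace G] [IsTopologicalAddGroup G] [T2Space G]
  [LocallyCompactSpace G] [SecondCountableTopology G] [MeasurableSpace G] [BorelSpace G]
  [AddCommGroup H] [TopologicalSpace H] [IsTopologicalAddGroup H] [T2Space H]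
  [LocallyCompactSpace H] [SecondCountableTopology H] [MeasurableSpace H] [BorelSpace H]
  {mG : Measure G} [mG.IsAddHaarMeasure] {mH : Measure H} [mH.IsAddHaarMeasure]
  {Γ : AddSubgroup (G × H)} {F : ℕ → Set G}

/-- Outer regularity lets `U` shrink to `K`, while thickening by `C` is negligible in the limit. -/
lemma asymptoticDensity_cutAndProjectSet_le (h : IsCutAndProjectScheme mG mH Γ)
    (hF : IsStrongFolner mG F) {K : Set H} (hK : IsCompact K) :
    asymptoticDensity mG F (cutAndProjectSet Γ K) ≤ (covol mG mH Γ)⁻¹ * mH K := by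
  rw [← ENNReal.mul_le_iff_le_inv h.lattice.covol_ne_zero h.lattice.covol_ne_top,
    K.measure_eq_iInf_isOpen]
  refine le_iInf₂ fun U hKU => le_iInf fun hU => ?_
  obtain ⟨C, hC, hCne, hle⟩ := h.covol_mul_cosetCount_le hK hU hKU
  have hlim := ENNReal.Tendsto.mul_const (b := (covol mG mH Γ)⁻¹ * mH U)
    (hF.thickening C hC hCne) (Or.inl one_ne_zero)
  rw [one_mul] at hlim
  rw [ENNReal.mul_le_iff_le_inv h.lattice.covol_ne_zero h.lattice.covol_ne_top, ← hlim.limsup_eq]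
  refine limsup_le_limsup (Eventually.of_forall fun n => ?_)
  have := hle (F n) (hF.compact n)
  rw [ENNReal.mul_le_iff_le_inv h.lattice.covol_ne_zero h.lattice.covol_ne_top] at this
  simp only [h.encard_inter]
  refine (ENNReal.div_le_div_right this _).trans_eq ?_
  simp only [div_eq_mul_inv]
  ring

/-- Inner regularity lets `K` exhaust `U`, with the erosion of `F n` by `C` in place of thickening.
-/
lemma le_asymptoticDensity_cutAndProjectSet (h : IsCutAndProjectScheme mG mH Γ)
    (hF : IsStrongFolner mG F) {U : Set H} (hU : IsOpen U) :
    (covol mG mH Γ)⁻¹ * mH U ≤ asymptoticDensity mG F (cutAndProjectSet Γ U) := by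
  have h0 := h.lattice.covol_ne_zero
  have htop := h.lattice.covol_ne_top
  rw [ENNReal.mul_le_iff_le_inv (ENNReal.inv_ne_zero.2 htop) (ENNReal.inv_ne_top.2 h0), inv_inv,
    hU.measure_eq_iSup_isCompact]
  refine iSup₂_le fun K hKU => iSup_le fun hK => ?_
  obtain ⟨C, hC, hle⟩ := h.le_covol_mul_cosetCount hK hU hKU
  obtain ⟨E, hE, hEC, a, ha, hale⟩ := hF.exists_erosion hC
  have hlim := ENNReal.Tendsto.mul_const (b := (covol mG mH Γ)⁻¹ * mH K) ha (Or.inl one_ne_zero)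
  rw [one_mul] at hlim
  rw [← inv_inv (covol mG mH Γ), ← ENNReal.mul_le_iff_le_inv (ENNReal.inv_ne_zero.2 htop)
    (ENNReal.inv_ne_top.2 h0), ← hlim.limsup_eq]
  refine limsup_le_limsup (Eventually.of_forall fun n => ?_)
  have := hle (F n) (E n) (hE n) (hEC n)
  rw [← inv_inv (covol mG mH Γ), ← ENNReal.mul_le_iff_le_inv (ENNReal.inv_ne_zero.2 htop)
    (ENNReal.inv_ne_top.2 h0)] at this
  simp only [h.encard_inter]
  refine le_trans ?_ (ENNReal.div_le_div_right this _)
  refine (mul_le_mul_left (hale n) _).trans_eq ?_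
  simp only [div_eq_mul_inv]
  ring

theorem asymptoticDensity_sub_bounds (h : IsCutAndProjectScheme mG mH Γ)
    (hF : IsStrongFolner mG F) {W : Set H} (hW : IsWindow mH W)
    (hWW : IsJordanMeasurable mH (W - W)) :
    asymptoticDensity mG F (cutAndProjectSet Γ W) = (covol mG mH Γ)⁻¹ * mH W ∧
    (covol mG mH Γ)⁻¹ * mH (interior W - interior W) ≤
      asymptoticDensity mG F (cutAndProjectSet Γ W - cutAndProjectSet Γ W) ∧
    asymptoticDensity mG F (cutAndProjectSet Γ W - cutAndProjectSet Γ W) ≤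
      (covol mG mH Γ)⁻¹ * mH (W - W) := by
  refine ⟨le_antisymm ?_ ?_, ?_, ?_⟩
  · rw [← measure_closure_of_null_frontier hW.jordan]
    exact (asymptoticDensity_mono _ _ (cutAndProjectSet_mono Γ subset_closure)).trans
      (asymptoticDensity_cutAndProjectSet_le h hF hW.relativelyCompact)
  · rw [← measure_interior_of_null_frontier hW.jordan]
    exact (le_asymptoticDensity_cutAndProjectSet h hF isOpen_interior).trans
      (asymptoticDensity_mono _ _ (cutAndProjectSet_mono Γ interior_subset))
  · exact (le_asymptoticDensity_cutAndProjectSet h hF isOpen_interior.sub_right).trans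
      (asymptoticDensity_mono _ _ (cutAndProjectSet_interior_sub_subset h.dense W))
  · have hc : IsCompact (closure W - closure W) := by
      simpa only [sub_eq_add_neg] using hW.relativelyCompact.add hW.relativelyCompact.neg
    rw [← measure_closure_of_null_frontier hWW]
    exact (asymptoticDensity_mono _ _ ((cutAndProjectSet_sub_subset Γ W W).trans
      (cutAndProjectSet_mono Γ subset_closure))).trans
      (asymptoticDensity_cutAndProjectSet_le h hF (hc.closure_of_subset
        (sub_subset_sub subset_closure subset_closure)))

end Density

/-! ### Intervals in the real line -/

section Real

lemma Icc_sub_Icc_self {a b : ℝ} (hab : a ≤ b) : Icc a b - Icc a b = Icc (a - b) (b - a) := by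
  ext x
  constructor
  · rintro ⟨y, hy, z, hz, rfl⟩
    exact ⟨by linarith [hy.1, hz.2], by linarith [hy.2, hz.1]⟩
  · rintro ⟨h1, h2⟩
    rcases le_total 0 x with hx | hx
    · exact ⟨a + x, ⟨by linarith, by linarith⟩, a, ⟨le_rfl, hab⟩, by ring⟩
    · exact ⟨a, ⟨le_rfl, hab⟩, a - x, ⟨by linarith, by linarith⟩, by ring⟩

lemma Ioo_subset_Ioo_sub_Ioo_self (a b : ℝ) : Ioo (a - b) (b - a) ⊆ Ioo a b - Ioo a b := by
  rintro x ⟨h1, h2⟩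
  -- Two points at distance `|x|`, symmetric about the midpoint of the interval.
  exact ⟨(a + b + x) / 2, ⟨by linarith, by linarith⟩, (a + b - x) / 2,
    ⟨by linarith, by linarith⟩, by ring⟩

lemma measure_Icc_real (m : Measure ℝ) [m.IsAddHaarMeasure] :
    ∃ c : ℝ≥0∞, ∀ a b, m (Icc a b) = c * ENNReal.ofReal (b - a) ∧
      m (Ioo a b) = c * ENNReal.ofReal (b - a) := by
  have h := m.isAddLeftInvariant_eq_smul volume
  generalize m.addHaarScalarFactor volume = c at h
  exact ⟨c, fun a b => by
    rw [h, Measure.smul_apply, Measure.smul_apply, Real.volume_Icc, Real.volume_Ioo]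
    exact ⟨rfl, rfl⟩⟩

end Real

end CutProject

theorem mainTheorem6
    {G : Type u} [AddCommGroup G] [TopologicalSpace G] [IsTopologicalAddGroup G] [T2Space G]
    [LocallyCompactSpace G] [SecondCountableTopology G] [MeasurableSpace G] [BorelSpace G]
    (mG : Measure G) [mG.IsAddHaarMeasure] :
    -- the densities of `P` and `P - P` for a general abelian cut-and-project scheme
    (∀ (H : Type v) [AddCommGroup H] [TopologicalSpace H] [IsTopologicalAddGroup H] [T2Space H]
      [LocallyCompactSpace H] [SecondCountableTopology H] [MeasurableSpace H] [BorelSpace H]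
      (mH : Measure H) [mH.IsAddHaarMeasure]
      (Γ : AddSubgroup (G × H)) (W : Set H),
      IsCutAndProjectScheme mG mH Γ → IsWindow mH W → IsJordanMeasurable mH (W - W) →
      ∀ F : ℕ → Set G, IsStrongFolner mG F →
        asymptoticDensity mG F (cutAndProjectSet Γ W) = (covol mG mH Γ)⁻¹ * mH W ∧
        (covol mG mH Γ)⁻¹ * mH (interior W - interior W) ≤
          asymptoticDensity mG F (cutAndProjectSet Γ W - cutAndProjectSet Γ W) ∧
        asymptoticDensity mG F (cutAndProjectSet Γ W - cutAndProjectSet Γ W) ≤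
          (covol mG mH Γ)⁻¹ * mH (W - W)) ∧
    -- the case where `H` is the real line and the window is a compact interval
    (∀ (mR : Measure ℝ) [mR.IsAddHaarMeasure] (Γ : AddSubgroup (G × ℝ)) (a b : ℝ),
      IsCutAndProjectScheme mG mR Γ → a < b →
      ∀ F : ℕ → Set G, IsStrongFolner mG F →
        asymptoticDensity mG F (cutAndProjectSet Γ (Icc a b) - cutAndProjectSet Γ (Icc a b)) =
          2 * (covol mG mR Γ)⁻¹ * mR (Icc a b) ∧
        asymptoticDensity mG F (cutAndProjectSet Γ (Icc a b) - cutAndProjectSet Γ (Icc a b)) =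
          2 * asymptoticDensity mG F (cutAndProjectSet Γ (Icc a b))) := by
  refine ⟨fun H _ _ _ _ _ _ _ _ mH _ Γ W h hW hWW F hF => asymptoticDensity_sub_bounds h hF hW hWW,
    fun mR _ Γ a b h hab F hF => ?_⟩
  obtain ⟨c, hc⟩ := measure_Icc_real mR
  have hjordan : ∀ x y : ℝ, x ≤ y → IsJordanMeasurable mR (Icc x y) := fun x y hxy => by
    rw [IsJordanMeasurable, frontier_Icc hxy]
    exact (toFinite {x, y}).measure_zero mR
  have hW : IsWindow mR (Icc a b) :=
    ⟨isCompact_Icc.closure, hjordan a b hab.le,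
      (Measure.measure_Ioo_pos mR).2 hab |>.trans_le (measure_mono Ioo_subset_Icc_self),
      isCompact_Icc.measure_lt_top⟩
  have hsub := Icc_sub_Icc_self hab.le
  obtain ⟨h1, h2, h3⟩ := asymptoticDensity_sub_bounds h hF hW
    (hsub ▸ hjordan _ _ (by linarith))
  have hdouble : c * ENNReal.ofReal (b - a - (a - b)) = 2 * mR (Icc a b) := by
    rw [(hc a b).1, show b - a - (a - b) = 2 * (b - a) by ring,
      ENNReal.ofReal_mul zero_le_two, ENNReal.ofReal_ofNat]
    ring
  have hmain : asymptoticDensity mG F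
      (cutAndProjectSet Γ (Icc a b) - cutAndProjectSet Γ (Icc a b)) =
        2 * (covol mG mR Γ)⁻¹ * mR (Icc a b) := by
    rw [mul_comm 2, mul_assoc, ← hdouble]
    -- The upper window `Icc (a - b) (b - a)` and the interval `Ioo (a - b) (b - a)` inside the
    -- lower one have equal measure.
    refine le_antisymm ?_ ?_
    · rwa [hsub, (hc _ _).1] at h3
    · refine le_trans ?_ h2
      rw [← (hc _ _).2, interior_Icc]
      gcongr
      exact Ioo_subset_Ioo_sub_Ioo_self a b
  exact ⟨hmain, by rw [hmain, h1, mul_assoc]⟩
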